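/- Consider a quantum Boltzmann machine with $n_V$ visible and $n_L$ latent qubits: its Hamiltonian is a Hermitian matrix $H=H_{\rm cl}+H_{\rm qm}$ on $\mathcal V\otimes\mathcal L=\mathbb{C}^{2^{n_V}}\otimes\mathbb{C}^{2^{n_L}}$, where $H_{\rm cl}=\sum_j b_j\hat n_j+\sum_{(j,k)\in E} w_{jk}\hat n_j\hat n_k$ with real $b_j,w_{jk}$ and $\hat n_j=(1-\sigma_z^{(j)})/2$, and where $H_{\rm qm}$ is not diagonal; its thermal state is $e^{-H}/Z$ with $Z=\mathrm{Tr}\,e^{-H}$. A training set consists of a probability distribution $(P_v)$ on finitely many labels $v$ and a POVM $(\Lambda_v)$ on $\mathcal V\otimes\mathcal L$ with pairwise distinct elements indexed by the same labels, each $\Lambda_v$ acting non-trivially only on $\mathcal V$. A general purpose POVM-based training algorithm is a family of quantum query algorithms, one for each value of a parameter $N$, each machine size and each POVM. It accesses $P$ only through queries $|v\rangle|y\rangle\mapsto|v\rangle|y+\lfloor 2^bP_v\rfloor \bmod 2^{b+1}\rangle$ (the precision $b$ being chosen by the algorithm), applies arbitrary $P$-independent unitaries on these registers and a finite workspace between the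 queries, and finally measures all registers and outputs a Hamiltonian $H$ as a function of the outcome. Let $p>0$ and $c<1$ be constants, and let $M(N)\in\mathbb{N}$ and $\Delta(N)>0$ satisfy $M\in o(\sqrt N)$ and $\Delta\in o(\sqrt N)$. Then there is no general purpose POVM-based training algorithm such that, for infinitely many $N$, the algorithm makes at most $M(N)$ queries and outputs, with probability at least $p$, the Hamiltonian $H$ of a quantum Boltzmann machine with $$\mathrm{Tr}\Big(\Big[\sum_v P_v\Lambda_v\Big]\frac{e^{-H}}{Z}\Big)\ \ge\ \frac1{\Delta(N)}$$ on every training set that has exactly $N$ labels $v$ with $P_v>0$ and for which some thermal state of a quantum Boltzmann machine attains $\mathrm{Tr}([\sum_v P_v\Lambda_v]e^{-H}/Z)\ge c$. The same holds with "exactly $N$ labels $v$ with $P_v>0$" replaced by "exactly $N$ labels, exactly one of which has $P_v>0$". -/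

import Mathlib

open Filter Asymptotics
open scoped Kronecker ComplexOrder

noncomputable section

namespace QBM

/-! ### Quantum Boltzmann machines -/

/-- The units (qubits) of a machine with `nV` visible and `nL` latent units. -/
abbrev Vertex (nV nL : ℕ) : Type := Fin nV ⊕ Fin nL

/-- The computational basis of `𝒱 ⊗ ℒ`, where `𝒱` is spanned by the configurations of the visible
units and `ℒ` by those of the latent units. -/
abbrev Config (nV nL : ℕ) : Type := (Fin nV → Fin 2) × (Fin nL → Fin 2)

/-- Linear operators on `𝒱 ⊗ ℒ`, as matrices in the computational basis. -/
abbrev Op (nV nL : ℕ) : Type := Matrix (Config nV nL) (Config nV nL) ℂ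

/-- The operator `σ_z` acting on unit `j`. -/
def pauliZ {nV nL : ℕ} (j : Vertex nV nL) : Op nV nL :=
  Matrix.diagonal fun x => (-1 : ℂ) ^ (Sum.elim x.1 x.2 j : Fin 2).val

/-- The number operator `(1 - σ_z) / 2` of unit `j`. -/
def numberOp {nV nL : ℕ} (j : Vertex nV nL) : Op nV nL :=
  (1 / 2 : ℂ) • (1 - pauliZ j)

/-- The classical Boltzmann Hamiltonian with biases `b`, edges `E` and weights `w`. -/
def classicalHamiltonian {nV nL : ℕ} (b : Vertex nV nL → ℝ)
    (E : Finset (Vertex nV nL × Vertex nV nL)) (w : Vertex nV nL × Vertex nV nL → ℝ) : Op nV nL :=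
  ∑ j, (b j : ℂ) • numberOp j + ∑ e ∈ E, (w e : ℂ) • (numberOp e.1 * numberOp e.2)

/-- `H` is the Hamiltonian of a quantum Boltzmann machine: a Hermitian matrix that is the sum of a
classical Boltzmann Hamiltonian and a matrix which is not diagonal. -/
def IsHamiltonian {nV nL : ℕ} (H : Op nV nL) : Prop :=
  H.IsHermitian ∧
    ∃ (b : Vertex nV nL → ℝ) (E : Finset (Vertex nV nL × Vertex nV nL))
      (w : Vertex nV nL × Vertex nV nL → ℝ) (Hqm : Op nV nL),
      H = classicalHamiltonian b E w + Hqm ∧ Hqm - Matrix.diagonal Hqm.diag ≠ 0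

/-- The thermal state `e^{-H} / Z`, where `Z = Tr e^{-H}`. -/
def thermalState {nV nL : ℕ} (H : Op nV nL) : Op nV nL :=
  (Matrix.trace (NormedSpace.exp (-H)))⁻¹ • NormedSpace.exp (-H)

/-! ### Training sets -/

/-- A POVM on `𝒱 ⊗ ℒ` with `K` labelled elements, each of which acts non-trivially only on `𝒱`. -/
structure POVM (nV nL K : ℕ) where
  /-- The POVM element with label `v`. -/
  effect : Fin K → Op nV nL
  posSemidef : ∀ v, (effect v).PosSemidef
  sum_eq_one : ∑ v, effect v = 1
  visible : ∀ v, ∃ E : Matrix (Fin nV → Fin 2) (Fin nV → Fin 2) ℂ,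
    effect v = E ⊗ₖ (1 : Matrix (Fin nL → Fin 2) (Fin nL → Fin 2) ℂ)

/-- A training set: a probability distribution and a POVM whose elements are in bijection with the
domain of the distribution. -/
structure TrainingSet (nV nL K : ℕ) where
  /-- The POVM. -/
  povm : POVM nV nL K
  /-- The probability of each label. -/
  P : Fin K → ℝ
  P_nonneg : ∀ v, 0 ≤ P v
  P_sum : ∑ v, P v = 1
  injective : Function.Injective povm.effect

/-- The number of labels `v` with `P_v > 0`. -/
def TrainingSet.numPos {nV nL K : ℕ} (S : TrainingSet nV nL K) : ℕ :=
  {v | 0 < S.P v}.ncard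

/-- The quantity `Tr ([∑ v, P_v Λ_v] e^{-H} / Z)` (which is real when `H` is Hermitian). -/
def TrainingSet.value {nV nL K : ℕ} (S : TrainingSet nV nL K) (H : Op nV nL) : ℝ :=
  (Matrix.trace ((∑ v, (S.P v : ℂ) • S.povm.effect v) * thermalState H)).re

/-! ### Quantum algorithms that query `P_v` -/

/-- The basis of the registers of a query algorithm: a label, a `(b + 1)`-bit answer and a
workspace of dimension `d`. -/
abbrev Register (K b d : ℕ) : Type := Fin K × ZMod (2 ^ (b + 1)) × Fin d

/-- One query: the unitary `|v⟩|y⟩|w⟩ ↦ |v⟩|y + P_v⟩|w⟩`, where `P_v` is written as the fixed-point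
number `⌊2 ^ b * P_v⌋` with `b` binary digits after the point. -/
def query {K b d : ℕ} (P : Fin K → ℝ) (ψ : Register K b d → ℂ) : Register K b d → ℂ :=
  fun x => ψ (x.1, x.2.1 - ((⌊(2 : ℝ) ^ b * P x.1⌋₊ : ℕ) : ZMod (2 ^ (b + 1))), x.2.2)

/-- A quantum algorithm which makes queries to `P_v`, interleaved with arbitrary unitaries that do
not depend on `P` (calls of a thermal state preparation are among these), measures all registers
at the end and outputs a Hamiltonian depending on the outcome. -/
structure QueryAlgorithm (nV nL K : ℕ) where
  /-- The number of binary digits of `P_v` that a query returns. -/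
  precision : ℕ
  /-- The dimension of the workspace. -/
  workDim : ℕ
  /-- The initial state. -/
  init : Register K precision workDim → ℂ
  init_norm : ∑ x, ‖init x‖ ^ 2 = 1
  /-- The number of queries. -/
  queries : ℕ
  /-- The unitary applied after each query. -/
  step : Fin queries → Matrix.unitaryGroup (Register K precision workDim) ℂ
  /-- The Hamiltonian that is output on each measurement outcome. -/
  output : Register K precision workDim → Op nV nL

/-- The state after the first `t` queries (and the unitaries that follow them). -/
def QueryAlgorithm.state {nV nL K : ℕ} (A : QueryAlgorithm nV nL K) (P : Fin K → ℝ) :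
    (t : ℕ) → t ≤ A.queries → Register K A.precision A.workDim → ℂ
  | 0, _ => A.init
  | t + 1, h =>
      (A.step ⟨t, h⟩ : Matrix _ _ ℂ).mulVec (query P (A.state P t (Nat.le_of_succ_le h)))

/-- The probability that the Hamiltonian output by the algorithm satisfies `good`. -/
def QueryAlgorithm.prob {nV nL K : ℕ} (A : QueryAlgorithm nV nL K) (P : Fin K → ℝ)
    (good : Set (Op nV nL)) : ℝ :=
  ∑ x, Set.indicator {x | A.output x ∈ good} (fun x => ‖A.state P A.queries le_rfl x‖ ^ 2) x

/-- A general purpose training algorithm: one query algorithm for each parameter `N`, each size of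
the machine and each POVM. The POVM is known to the algorithm, the distribution is not. -/
abbrev TrainingAlgorithm : Type :=
  (N nV nL K : ℕ) → POVM nV nL K → QueryAlgorithm nV nL K

/-- A class of training sets. -/
abbrev TrainingClass : Type := ∀ ⦃nV nL K : ℕ⦄, TrainingSet nV nL K → Prop

/-- With parameter `N`, the algorithm `A` makes at most `M` queries to `P_v` and, for each training
set in `𝒞`, outputs with probability at least `p` the Hamiltonian `H` of a quantum Boltzmann
machine with `Tr ([∑ v, P_v Λ_v] e^{-H} / Z) ≥ 1 / Δ`. -/
def TrainingAlgorithm.Trains (A : TrainingAlgorithm) (N : ℕ) (𝒞 : TrainingClass)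
    (M : ℕ) (Δ p : ℝ) : Prop :=
  ∀ ⦃nV nL K : ℕ⦄ (S : TrainingSet nV nL K), 𝒞 S →
    (A N nV nL K S.povm).queries ≤ M ∧
    p ≤ (A N nV nL K S.povm).prob S.P {H | IsHamiltonian H ∧ 1 / Δ ≤ S.value H}

/-- Some thermal state of a quantum Boltzmann machine attains at least the value `c`. -/
def TrainingSet.Attains {nV nL K : ℕ} (S : TrainingSet nV nL K) (c : ℝ) : Prop :=
  ∃ H : Op nV nL, IsHamiltonian H ∧ c ≤ S.value H

end QBM

end

/-!
The proof embeds unstructured search into training. The visible configurations are mapped onto `N`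
labels by a surjection `f`, the POVM is the projective measurement of `f`, and `P` is concentrated
on one hidden label `m`, up to a background probability `δ` on every label (`hidingSet`). The
background is zero when only one label may be positive. When all `N` labels must be positive, `δ`
is taken below `2 ^ (-b)`, where `b` is the precision of the algorithm, so that the queries still
answer `0` on every label except `m`. A cold thermal state localized on a configuration in the
fibre of `m` shows that these training sets are trainable (`attains_of_lt`).

Two counting facts then bound the success probability averaged over `m`.
* A thermal state of value at least `1 / Δ` puts weight at least `1 / (2 * Δ)` on the fibre of `m`.
  The weights of the fibres sum to at most one, so each output is good for at most `2 * Δ` hidden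
  labels (`sum_indicator_good_le`).
* By the hybrid argument, `T` queries move the final state away from that of the run with the
  all-zero oracle by at most twice the total query amplitude on `m`, and the sum over `m` of the
  squared distances is at most `4 * T ^ 2` (`QueryAlgorithm.sum_l2norm_state_sub_sq_le`).

The success probabilities thus sum to at most `4 * Δ + 8 * T ^ 2`, whereas training would make the
sum at least `p * N`. This is impossible for large `N`, as `Δ` and `T ^ 2` are both `o(N)`.
-/

namespace QBM

/-! ### The hybrid argument -/

/-- The `ℓ²` norm of an (unnormalized) state vector. -/
noncomputable def l2norm {X : Type*} [Fintype X] (ψ : X → ℂ) : ℝ := ‖WithLp.toLp 2 ψ‖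

section l2norm

variable {X : Type*} [Fintype X]

lemma l2norm_nonneg (ψ : X → ℂ) : 0 ≤ l2norm ψ := norm_nonneg _

lemma l2norm_sq (ψ : X → ℂ) : l2norm ψ ^ 2 = ∑ x, ‖ψ x‖ ^ 2 :=
  EuclideanSpace.norm_sq_eq _

lemma l2norm_add_le (φ ψ : X → ℂ) : l2norm (φ + ψ) ≤ l2norm φ + l2norm ψ := by
  simpa [l2norm] using norm_add_le (WithLp.toLp 2 φ) (WithLp.toLp 2 ψ)

lemma l2norm_sub_le (φ ψ : X → ℂ) : l2norm (φ - ψ) ≤ l2norm φ + l2norm ψ := by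
  simpa [l2norm] using norm_sub_le (WithLp.toLp 2 φ) (WithLp.toLp 2 ψ)

lemma l2norm_unitary_mulVec [DecidableEq X] (U : Matrix.unitaryGroup X ℂ) (ψ : X → ℂ) :
    l2norm ((U : Matrix X X ℂ).mulVec ψ) = l2norm ψ := by
  have key : ∀ φ : X → ℂ, ((l2norm φ ^ 2 : ℝ) : ℂ) = star φ ⬝ᵥ φ := by
    intro φ
    rw [l2norm_sq]
    push_cast
    refine Finset.sum_congr rfl fun x _ => ?_
    simp [← Complex.conj_mul']
  have h : l2norm ((U : Matrix X X ℂ).mulVec ψ) ^ 2 = l2norm ψ ^ 2 := by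
    have hU : (U : Matrix X X ℂ).conjTranspose * (U : Matrix X X ℂ) = 1 :=
      Matrix.mem_unitaryGroup_iff'.mp U.2
    have : ((l2norm ((U : Matrix X X ℂ).mulVec ψ) ^ 2 : ℝ) : ℂ) = ((l2norm ψ ^ 2 : ℝ) : ℂ) := by
      rw [key, key, Matrix.star_mulVec, ← Matrix.dotProduct_mulVec, Matrix.mulVec_mulVec, hU,
        Matrix.one_mulVec]
    exact_mod_cast this
  exact (sq_eq_sq₀ (l2norm_nonneg _) (l2norm_nonneg _)).mp h

end l2norm

variable {K b d : ℕ}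

lemma query_sub (P : Fin K → ℝ) (φ ψ : Register K b d → ℂ) :
    query P (φ - ψ) = query P φ - query P ψ := rfl

lemma query_zero (ψ : Register K b d → ℂ) : query 0 ψ = ψ := by
  funext x
  simp [query]

lemma l2norm_query (P : Fin K → ℝ) (ψ : Register K b d → ℂ) : l2norm (query P ψ) = l2norm ψ := by
  have h : l2norm (query P ψ) ^ 2 = l2norm ψ ^ 2 := by
    rw [l2norm_sq, l2norm_sq, Fintype.sum_prod_type, Fintype.sum_prod_type]
    refine Finset.sum_congr rfl fun v _ => ?_
    rw [Fintype.sum_prod_type, Fintype.sum_prod_type]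
    exact Equiv.sum_comp (Equiv.subRight ((⌊(2 : ℝ) ^ b * P v⌋₊ : ℕ) : ZMod (2 ^ (b + 1))))
      fun y => ∑ w, ‖ψ (v, y, w)‖ ^ 2
  exact (sq_eq_sq₀ (l2norm_nonneg _) (l2norm_nonneg _)).mp h

/-- The component of a state whose label register holds `m`. -/
def labelPart (m : Fin K) (ψ : Register K b d → ℂ) : Register K b d → ℂ :=
  fun x => if x.1 = m then ψ x else 0

lemma sum_l2norm_labelPart_sq (ψ : Register K b d → ℂ) :
    ∑ m, l2norm (labelPart m ψ) ^ 2 = l2norm ψ ^ 2 := by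
  simp_rw [l2norm_sq]
  rw [Finset.sum_comm]
  refine Finset.sum_congr rfl fun x _ => ?_
  rw [Finset.sum_eq_single x.1]
  · simp [labelPart]
  · intro m _ hm
    simp [labelPart, hm.symm]
  · simp

/-- A query that answers `0` on every label other than `m` moves a state by at most twice its
component on the label `m`. -/
lemma l2norm_query_sub_self_le {P : Fin K → ℝ} {m : Fin K}
    (hP : ∀ v ≠ m, ⌊(2 : ℝ) ^ b * P v⌋₊ = 0) (ψ : Register K b d → ℂ) :
    l2norm (query P ψ - ψ) ≤ 2 * l2norm (labelPart m ψ) := by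
  have h : query P ψ - ψ = query P (labelPart m ψ) - labelPart m ψ := by
    funext x
    by_cases hx : x.1 = m
    · simp [query, labelPart, hx]
    · simp [query, labelPart, hx, hP x.1 hx]
  rw [h]
  refine (l2norm_sub_le _ _).trans ?_
  rw [l2norm_query, two_mul]

namespace QueryAlgorithm

variable {nV nL : ℕ} (A : QueryAlgorithm nV nL K)

lemma l2norm_state (P : Fin K → ℝ) : ∀ (t : ℕ) (ht : t ≤ A.queries), l2norm (A.state P t ht) = 1
  | 0, _ => by
    rw [← sq_eq_sq₀ (l2norm_nonneg _) zero_le_one, l2norm_sq]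
    simpa [state] using A.init_norm
  | t + 1, h => by
    rw [state, l2norm_unitary_mulVec, l2norm_query, l2norm_state P t]

/-- If the oracle for `P` differs from the all-zero oracle on the label `m` only, then the two runs
of the algorithm drift apart by at most twice the total query amplitude on `m` of the run with the
all-zero oracle. -/
lemma l2norm_state_sub_le {P : Fin K → ℝ} {m : Fin K}
    (hP : ∀ v ≠ m, ⌊(2 : ℝ) ^ A.precision * P v⌋₊ = 0) :
    ∀ (t : ℕ) (ht : t ≤ A.queries), l2norm (A.state P t ht - A.state 0 t ht) ≤
      2 * ∑ i : Fin t, l2norm (labelPart m (A.state 0 i (i.2.le.trans ht)))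
  | 0, _ => by simp [state, l2norm]
  | t + 1, h => by
    have ht : t ≤ A.queries := Nat.le_of_succ_le h
    have ih := l2norm_state_sub_le hP t ht
    have hdec : query P (A.state P t ht) - A.state 0 t ht =
        query P (A.state P t ht - A.state 0 t ht) +
          (query P (A.state 0 t ht) - A.state 0 t ht) := by
      rw [query_sub]; abel
    rw [state, state, ← Matrix.mulVec_sub, l2norm_unitary_mulVec, query_zero, hdec,
      Fin.sum_univ_castSucc]
    refine (l2norm_add_le _ _).trans ?_
    rw [l2norm_query, mul_add]
    exact add_le_add ih (l2norm_query_sub_self_le hP _)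

/-- On average over the marked label `m`, `T` queries move the final state by `O(T ^ 2 / K)` in
squared norm. -/
lemma sum_l2norm_state_sub_sq_le (P : Fin K → Fin K → ℝ)
    (hP : ∀ m, ∀ v ≠ m, ⌊(2 : ℝ) ^ A.precision * P m v⌋₊ = 0) :
    ∑ m, l2norm (A.state (P m) A.queries le_rfl - A.state 0 A.queries le_rfl) ^ 2 ≤
      4 * (A.queries : ℝ) ^ 2 := by
  have h1 : ∀ m, l2norm (A.state (P m) A.queries le_rfl - A.state 0 A.queries le_rfl) ^ 2 ≤
      4 * (A.queries * ∑ i : Fin A.queries, l2norm (labelPart m (A.state 0 i i.2.le)) ^ 2) := by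
    intro m
    have h := A.l2norm_state_sub_le (hP m) A.queries le_rfl
    have h' := pow_le_pow_left₀ (l2norm_nonneg _) h 2
    have hcs := sq_sum_le_card_mul_sum_sq (s := Finset.univ)
      (f := fun i : Fin A.queries => l2norm (labelPart m (A.state 0 i i.2.le)))
    rw [Finset.card_univ, Fintype.card_fin] at hcs
    rw [mul_pow] at h'
    linarith
  refine (Finset.sum_le_sum fun m _ => h1 m).trans (le_of_eq ?_)
  rw [← Finset.mul_sum, ← Finset.mul_sum, Finset.sum_comm]
  simp_rw [sum_l2norm_labelPart_sq, l2norm_state]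
  simp
  ring

/-- If every operator is good for at most `L` labels `m`, an algorithm with `T` queries succeeds on
the inputs that hide a single label `m` with probability `O((L + T ^ 2) / K)` on average. -/
lemma sum_prob_le (P : Fin K → Fin K → ℝ)
    (hP : ∀ m, ∀ v ≠ m, ⌊(2 : ℝ) ^ A.precision * P m v⌋₊ = 0)
    (good : Fin K → Set (Op nV nL)) {L : ℝ}
    (hL : ∀ H, ∑ m, Set.indicator (good m) (fun _ => (1 : ℝ)) H ≤ L) :
    ∑ m, A.prob (P m) (good m) ≤ 2 * L + 8 * (A.queries : ℝ) ^ 2 := by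
  set φ := A.state 0 A.queries le_rfl with hφ
  have h1 : ∀ m, A.prob (P m) (good m) ≤
      2 * ∑ x, Set.indicator (good m) (fun _ => (1 : ℝ)) (A.output x) * ‖φ x‖ ^ 2 +
        2 * l2norm (A.state (P m) A.queries le_rfl - φ) ^ 2 := by
    intro m
    rw [prob, l2norm_sq, Finset.mul_sum, Finset.mul_sum, ← Finset.sum_add_distrib]
    refine Finset.sum_le_sum fun x _ => ?_
    set ψ := A.state (P m) A.queries le_rfl
    by_cases hx : A.output x ∈ good m
    · rw [Set.indicator_of_mem (show x ∈ {x | A.output x ∈ good m} from hx),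
        Set.indicator_of_mem hx]
      have htri : ‖ψ x‖ ≤ ‖φ x‖ + ‖(ψ - φ) x‖ := by
        have := norm_add_le (φ x) (ψ x - φ x)
        simpa using this
      have := pow_le_pow_left₀ (norm_nonneg _) htri 2
      nlinarith [sq_nonneg (‖φ x‖ - ‖(ψ - φ) x‖)]
    · rw [Set.indicator_of_notMem (show x ∉ {x | A.output x ∈ good m} from hx),
        Set.indicator_of_notMem hx]
      positivity
  have h2 : ∑ m, ∑ x, Set.indicator (good m) (fun _ => (1 : ℝ)) (A.output x) * ‖φ x‖ ^ 2 ≤ L := by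
    rw [Finset.sum_comm]
    simp_rw [← Finset.sum_mul]
    refine (Finset.sum_le_sum fun x _ =>
      mul_le_mul_of_nonneg_right (hL (A.output x)) (sq_nonneg _)).trans (le_of_eq ?_)
    rw [← Finset.mul_sum, ← l2norm_sq, hφ, l2norm_state]
    simp
  have h3 := A.sum_l2norm_state_sub_sq_le P hP
  refine (Finset.sum_le_sum fun m _ => h1 m).trans ?_
  rw [Finset.sum_add_distrib, ← Finset.mul_sum, ← Finset.mul_sum]
  linarith

end QueryAlgorithm

/-! ### Thermal states -/

section thermalState

variable {nV nL : ℕ}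

lemma exp_neg_posSemidef {H : Op nV nL} (hH : H.IsHermitian) :
    (NormedSpace.exp (-H)).PosSemidef := by
  set B : Op nV nL := NormedSpace.exp (-((1 / 2 : ℂ) • H)) with hB
  have hBH : B.IsHermitian := by
    refine Matrix.IsHermitian.exp ?_
    refine Matrix.IsHermitian.neg ?_
    rw [Matrix.IsHermitian, Matrix.conjTranspose_smul, hH.eq]
    simp
  have h : NormedSpace.exp (-H) = B.conjTranspose * B := by
    rw [hBH.eq, hB, ← Matrix.exp_add_of_commute _ _ (Commute.refl _), ← neg_add, ← add_smul]
    norm_num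
  rw [h]
  exact Matrix.posSemidef_conjTranspose_mul_self B

lemma thermalState_diag_nonneg {H : Op nV nL} (hH : H.IsHermitian) (x : Config nV nL) :
    0 ≤ (thermalState H x x).re := by
  have h := exp_neg_posSemidef hH
  have h1 : 0 ≤ (Matrix.trace (NormedSpace.exp (-H)))⁻¹ := inv_nonneg.mpr h.trace_nonneg
  have h2 : 0 ≤ thermalState H x x := by
    rw [thermalState, Matrix.smul_apply, smul_eq_mul]
    exact mul_nonneg h1 h.diag_nonneg
  exact (Complex.le_def.mp h2).1

lemma sum_thermalState_diag_le (H : Op nV nL) : ∑ x, (thermalState H x x).re ≤ 1 := by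
  have h : ∑ x, (thermalState H x x).re = (Matrix.trace (thermalState H)).re := by
    simp [Matrix.trace]
  rw [h, thermalState, Matrix.trace_smul, smul_eq_mul]
  rcases eq_or_ne (Matrix.trace (NormedSpace.exp (-H))) 0 with h0 | h0
  · simp [h0]
  · simp [inv_mul_cancel₀ h0]

lemma thermalState_diagonal (E : Config nV nL → ℝ) (x : Config nV nL) :
    thermalState (Matrix.diagonal fun y => (E y : ℂ)) x x =
      ((Real.exp (-E x) / ∑ y, Real.exp (-E y) : ℝ) : ℂ) := by
  have h : NormedSpace.exp (-(Matrix.diagonal fun y => (E y : ℂ)) : Op nV nL) =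
      Matrix.diagonal fun y => ((Real.exp (-E y) : ℝ) : ℂ) := by
    rw [Matrix.diagonal_neg, Matrix.exp_diagonal]
    congr 1
    funext y
    rw [Pi.coe_exp]
    simp [← Complex.exp_eq_exp_ℂ]
  rw [thermalState, h, Matrix.trace_diagonal, Matrix.smul_apply, Matrix.diagonal_apply_eq,
    smul_eq_mul]
  push_cast
  rw [div_eq_inv_mul]

open scoped Matrix.Norms.Operator in
lemma continuous_exp_neg : Continuous fun H : Op nV nL => NormedSpace.exp (-H) :=
  NormedSpace.exp_continuous.comp continuous_neg

lemma continuousAt_thermalState {H : Op nV nL} (hH : Matrix.trace (NormedSpace.exp (-H)) ≠ 0) :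
    ContinuousAt thermalState H := by
  have h := (continuous_exp_neg (nV := nV) (nL := nL)).continuousAt (x := H)
  have ht : ContinuousAt (fun H : Op nV nL => Matrix.trace (NormedSpace.exp (-H))) H :=
    (Continuous.matrix_trace continuous_exp_neg).continuousAt
  exact (ht.inv₀ hH).smul h

/-- Every non-diagonal Hermitian matrix is the Hamiltonian of a quantum Boltzmann machine, with
vanishing biases and weights. -/
lemma isHamiltonian_of_apply_ne_zero {H : Op nV nL} (hH : H.IsHermitian) {x y : Config nV nL}
    (hxy : x ≠ y) (h : H x y ≠ 0) : IsHamiltonian H := by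
  refine ⟨hH, 0, ∅, 0, H, by simp [classicalHamiltonian], fun h0 => h ?_⟩
  have := congrFun (congrFun h0 x) y
  simpa [Matrix.diagonal_apply_ne _ hxy] using this

end thermalState

/-! ### Training sets that hide a label -/

section HidingSet

variable {nV nL K : ℕ}

/-- The projective measurement of `f` applied to the configuration of the visible units. -/
def fibrePOVM (nL : ℕ) (f : (Fin nV → Fin 2) → Fin K) : POVM nV nL K where
  effect v := Matrix.diagonal fun x => if f x.1 = v then 1 else 0
  posSemidef v := by
    refine Matrix.PosSemidef.diagonal fun x => ?_
    dsimp only [Pi.zero_apply]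
    split_ifs
    · exact zero_le_one
    · exact le_rfl
  sum_eq_one := by
    ext x y
    rw [Matrix.sum_apply]
    by_cases hxy : x = y
    · subst hxy
      simp
    · simp [Matrix.diagonal_apply_ne _ hxy, Matrix.one_apply_ne hxy]
  visible v := ⟨Matrix.diagonal fun x => if f x = v then 1 else 0, by
    rw [← Matrix.diagonal_one, Matrix.diagonal_kronecker_diagonal]
    simp⟩

lemma fibrePOVM_effect_injective {f : (Fin nV → Fin 2) → Fin K} (hf : Function.Surjective f) :
    Function.Injective (fibrePOVM nL f).effect := by
  intro v w h
  obtain ⟨x, rfl⟩ := hf v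
  by_contra hvw
  have := congrFun (congrFun h (x, 0)) (x, 0)
  simp [fibrePOVM, hvw] at this

/-- The value of a Hamiltonian is the mean of `P` over the outcome of the fibre measurement. -/
lemma value_of_povm_eq_fibrePOVM {f : (Fin nV → Fin 2) → Fin K} {S : TrainingSet nV nL K}
    (hS : S.povm = fibrePOVM nL f) (H : Op nV nL) :
    S.value H = ∑ x, S.P (f x.1) * (thermalState H x x).re := by
  have h : ∑ v, (S.P v : ℂ) • S.povm.effect v =
      Matrix.diagonal fun x : Config nV nL => (S.P (f x.1) : ℂ) := by
    rw [hS]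
    ext x y
    rw [Matrix.sum_apply]
    by_cases hxy : x = y
    · subst hxy
      simp [fibrePOVM]
    · simp [fibrePOVM, Matrix.diagonal_apply_ne _ hxy]
  rw [TrainingSet.value, h, Matrix.trace, Complex.re_sum]
  refine Finset.sum_congr rfl fun x _ => ?_
  rw [Matrix.diag_apply, Matrix.diagonal_mul, Complex.re_ofReal_mul]

/-- Any value below `P m` is attained: a cold diagonal Hamiltonian whose ground state is a
configuration in the fibre of `m` has value close to `P m`, and a small off-diagonal perturbation
makes it the Hamiltonian of a quantum Boltzmann machine. -/
lemma attains_of_lt {f : (Fin nV → Fin 2) → Fin K} {S : TrainingSet nV nL K}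
    (hS : S.povm = fibrePOVM nL f) {a a' : Config nV nL} (ha : a ≠ a') {c : ℝ}
    (hc : c < S.P (f a.1)) : S.Attains c := by
  classical
  set n : ℝ := (Fintype.card (Config nV nL) : ℝ)
  obtain ⟨β, hβ⟩ : ∃ β : ℝ, c < S.P (f a.1) * (1 + n * Real.exp (-β))⁻¹ := by
    have h : Tendsto (fun β : ℝ => S.P (f a.1) * (1 + n * Real.exp (-β))⁻¹) atTop
        (nhds (S.P (f a.1) * (1 + n * 0)⁻¹)) := by
      refine Tendsto.const_mul _ (Tendsto.inv₀ ?_ (by simp))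
      exact (Real.tendsto_exp_neg_atTop_nhds_zero.const_mul n).const_add 1
    exact (h.eventually_const_lt (by simpa using hc)).exists
  set E : Config nV nL → ℝ := fun y => if y = a then 0 else β with hE
  set D : Op nV nL := Matrix.diagonal fun y => (E y : ℂ) with hD
  have hZ : 0 < ∑ y, Real.exp (-E y) :=
    Finset.sum_pos (fun y _ => Real.exp_pos _) ⟨a, Finset.mem_univ a⟩
  have hZle : ∑ y, Real.exp (-E y) ≤ 1 + n * Real.exp (-β) := by
    have h : ∀ y, Real.exp (-E y) ≤ (if y = a then 1 else 0) + Real.exp (-β) := by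
      intro y
      by_cases hy : y = a
      · simp [hE, hy, (Real.exp_pos _).le]
      · simp [hE, hy]
    refine (Finset.sum_le_sum fun y _ => h y).trans (le_of_eq ?_)
    rw [Finset.sum_add_distrib]
    simp [n]
  have hDval : c < S.value D := by
    refine hβ.trans_le ?_
    rw [value_of_povm_eq_fibrePOVM hS]
    have hterm : ∀ x, (thermalState D x x).re = Real.exp (-E x) / ∑ y, Real.exp (-E y) := by
      intro x
      rw [hD, thermalState_diagonal, Complex.ofReal_re]
    refine le_trans ?_ (Finset.single_le_sum (f := fun x => S.P (f x.1) * (thermalState D x x).re)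
      (fun x _ => mul_nonneg (S.P_nonneg _) ?_) (Finset.mem_univ a))
    · rw [hterm]
      refine mul_le_mul_of_nonneg_left ?_ (S.P_nonneg _)
      simp only [hE, if_true, neg_zero, Real.exp_zero, one_div]
      exact inv_anti₀ hZ hZle
    · rw [hterm]
      positivity
  have htrace : Matrix.trace (NormedSpace.exp (-D)) ≠ 0 := by
    intro h0
    have h := thermalState_diagonal E a
    rw [← hD, thermalState, h0, inv_zero, zero_smul, Matrix.zero_apply] at h
    have : 0 < Real.exp (-E a) / ∑ y, Real.exp (-E y) := div_pos (Real.exp_pos _) hZ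
    exact this.ne (by exact_mod_cast h)
  set J : Op nV nL := Matrix.of fun _ _ => 1 with hJ
  have hcont : ContinuousAt (fun t : ℝ => S.value (D + (t : ℂ) • J)) 0 := by
    have hin : Continuous fun t : ℝ => D + (t : ℂ) • J := by fun_prop
    have h1 : ContinuousAt (fun t : ℝ => thermalState (D + (t : ℂ) • J)) 0 :=
      ContinuousAt.comp (f := fun t : ℝ => D + (t : ℂ) • J) (g := thermalState)
        (continuousAt_thermalState (by simpa using htrace)) hin.continuousAt
    have h2 : Continuous fun ρ : Op nV nL =>
        (Matrix.trace ((∑ v, (S.P v : ℂ) • S.povm.effect v) * ρ)).re :=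
      Complex.continuous_re.comp
        (Continuous.matrix_trace (continuous_const.matrix_mul continuous_id))
    exact ContinuousAt.comp (f := fun t : ℝ => thermalState (D + (t : ℂ) • J))
      h2.continuousAt h1
  have hev : ∀ᶠ t : ℝ in nhdsWithin 0 {0}ᶜ, c < S.value (D + (t : ℂ) • J) ∧ t ≠ 0 := by
    refine Eventually.and ?_ self_mem_nhdsWithin
    refine (hcont.mono_left nhdsWithin_le_nhds).eventually_const_lt ?_
    simpa using hDval
  obtain ⟨t, ht, ht0⟩ := hev.exists
  refine ⟨D + (t : ℂ) • J, isHamiltonian_of_apply_ne_zero ?_ ha ?_, ht.le⟩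
  · refine Matrix.IsHermitian.add ?_ ?_
    · refine Matrix.isHermitian_diagonal_of_self_adjoint _ ?_
      funext y
      simp
    · ext x y
      simp [hJ]
  · simp [hD, hJ, Matrix.diagonal_apply_ne _ ha, ht0]

/-- The training set on the fibres of `f` in which every label has probability `δ`, except that the
label `m` has the remaining probability. -/
def hidingSet (nL : ℕ) {f : (Fin nV → Fin 2) → Fin K} (hf : Function.Surjective f) {δ : ℝ}
    (hδ : 0 ≤ δ) (hKδ : K * δ ≤ 1) (m : Fin K) : TrainingSet nV nL K where
  povm := fibrePOVM nL f
  P v := δ + if v = m then 1 - K * δ else 0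
  P_nonneg v := by
    split_ifs
    · linarith
    · linarith
  P_sum := by
    rw [Finset.sum_add_distrib]
    simp
  injective := fibrePOVM_effect_injective hf

variable {f : (Fin nV → Fin 2) → Fin K} (hf : Function.Surjective f) {δ : ℝ} (hδ : 0 ≤ δ)
  (hKδ : K * δ ≤ 1)

lemma numPos_hidingSet_of_pos (h : 0 < δ) (m : Fin K) :
    (hidingSet nL hf hδ hKδ m).numPos = K := by
  have : {v | 0 < (hidingSet nL hf hδ hKδ m).P v} = Set.univ := by
    refine Set.eq_univ_of_forall fun v => ?_
    rw [Set.mem_ofPred_eq, hidingSet]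
    dsimp only
    split_ifs
    · linarith
    · linarith
  rw [TrainingSet.numPos, this, Set.ncard_univ, Nat.card_eq_fintype_card, Fintype.card_fin]

lemma numPos_hidingSet_of_eq_zero (h : δ = 0) (m : Fin K) :
    (hidingSet nL hf hδ hKδ m).numPos = 1 := by
  subst h
  have : {v | 0 < (hidingSet nL hf hδ hKδ m).P v} = {m} := by
    ext v
    by_cases hv : v = m
    · simp [hidingSet, hv]
    · simp [hidingSet, hv]
  rw [TrainingSet.numPos, this, Set.ncard_singleton]

/-- A Hamiltonian of value at least `1 / Δ` puts weight at least `1 / (2 * Δ)` on the hidden label,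
as the other labels contribute at most `δ`; so it is good for at most `2 * Δ` hidden labels. -/
lemma sum_indicator_good_le {Δ : ℝ} (hΔ : 0 < Δ) (hδΔ : 2 * Δ * δ ≤ 1) (H : Op nV nL) :
    ∑ m, Set.indicator {H | IsHamiltonian H ∧ 1 / Δ ≤ (hidingSet nL hf hδ hKδ m).value H}
      (fun _ => (1 : ℝ)) H ≤ 2 * Δ := by
  by_cases hH : IsHamiltonian H
  swap
  · rw [Finset.sum_eq_zero]
    · positivity
    · intro m _
      exact Set.indicator_of_notMem (fun h => hH h.1) _
  set ρ : Config nV nL → ℝ := fun x => (thermalState H x x).re with hρ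
  have hρ0 : ∀ x, 0 ≤ ρ x := thermalState_diag_nonneg hH.1
  have hρ1 : ∑ x, ρ x ≤ 1 := sum_thermalState_diag_le H
  set q : Fin K → ℝ := fun m => ∑ x, if f x.1 = m then ρ x else 0 with hq
  have hq0 : ∀ m, 0 ≤ q m := fun m => Finset.sum_nonneg fun x _ => by
    split_ifs
    exacts [hρ0 x, le_rfl]
  have hq1 : ∑ m, q m ≤ 1 := by
    rw [hq, Finset.sum_comm]
    simpa using hρ1
  have hval : ∀ m, (hidingSet nL hf hδ hKδ m).value H ≤ δ + q m := by
    intro m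
    have h1 : (hidingSet nL hf hδ hKδ m).value H = δ * ∑ x, ρ x + (1 - K * δ) * q m := by
      rw [value_of_povm_eq_fibrePOVM (f := f) rfl, hq, Finset.mul_sum, Finset.mul_sum,
        ← Finset.sum_add_distrib]
      refine Finset.sum_congr rfl fun x _ => ?_
      simp only [hidingSet]
      split_ifs <;> ring
    have h2 : 0 ≤ K * δ * q m := by have := hq0 m; positivity
    have h3 : δ * ∑ x, ρ x ≤ δ * 1 := mul_le_mul_of_nonneg_left hρ1 hδ
    rw [h1]
    linarith
  have hind : ∀ m, Set.indicator
      {H | IsHamiltonian H ∧ 1 / Δ ≤ (hidingSet nL hf hδ hKδ m).value H}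
      (fun _ => (1 : ℝ)) H ≤ 2 * Δ * q m := by
    intro m
    refine Set.indicator_apply_le' (fun h => ?_) fun _ => ?_
    · have h1 := h.2.trans (hval m)
      rw [div_le_iff₀ hΔ] at h1
      linarith
    · have := hq0 m
      positivity
  refine (Finset.sum_le_sum fun m _ => hind m).trans ?_
  rw [← Finset.mul_sum]
  have := mul_le_mul_of_nonneg_left hq1 (by positivity : 0 ≤ 2 * Δ)
  linarith

end HidingSet

/-! ### The query bound -/

lemma exists_surjective_config (N : ℕ) (hN : 0 < N) :
    ∃ f : (Fin N → Fin 2) → Fin N, Function.Surjective f := by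
  have : Nonempty (Fin N) := ⟨⟨0, hN⟩⟩
  have hcard : Fintype.card (Fin N) ≤ Fintype.card (Fin N → Fin 2) := by
    simpa using Nat.lt_two_pow_self.le
  obtain ⟨g⟩ := Function.Embedding.nonempty_of_card_le hcard
  exact ⟨Function.invFun g, Function.invFun_surjective g.injective⟩

/-- An algorithm that trains the hiding sets with `N` labels satisfies `p * N ≤ 4 * Δ + 8 * M ^ 2`.
The background probability `δ` is chosen after the precision of the algorithm is known, so it is
enough that the class contains the hiding sets for some arbitrarily small `δ`, namely those with
`allowed δ`. -/
lemma TrainingAlgorithm.Trains.le_of_hidingSet {A : TrainingAlgorithm} {N M : ℕ} {Δ p c : ℝ}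
    {𝒞 : TrainingClass} (hA : A.Trains N 𝒞 M Δ p) (hN : 0 < N) (hc : c < 1) (hΔ : 0 < Δ)
    {allowed : ℝ → Prop} (hallowed : ∀ r > 0, ∃ δ, 0 ≤ δ ∧ δ < r ∧ allowed δ)
    (h𝒞 : ∀ {f : (Fin N → Fin 2) → Fin N} (hf : Function.Surjective f) {δ : ℝ} (hδ : 0 ≤ δ)
      (hKδ : N * δ ≤ 1) (m : Fin N), allowed δ → (hidingSet 1 hf hδ hKδ m).Attains c →
        𝒞 (hidingSet 1 hf hδ hKδ m)) :
    p * N ≤ 4 * Δ + 8 * (M : ℝ) ^ 2 := by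
  obtain ⟨f, hf⟩ := exists_surjective_config N hN
  have hN' : (0 : ℝ) < N := by exact_mod_cast hN
  set B := A N N 1 N (fibrePOVM 1 f)
  -- `δ` is so small that the oracle rounds it to zero, that the background contributes at most
  -- half of the required value, and that the hidden label has probability above `c`.
  obtain ⟨δ, hδ, hδr, hδa⟩ := hallowed
    (min (1 / 2 ^ B.precision) (min (1 / (2 * Δ)) (min (1 / N) ((1 - c) / N))))
    (by
      have : 0 < 1 - c := by linarith
      positivity)
  obtain ⟨h1, h2, h3, h4⟩ : δ < 1 / 2 ^ B.precision ∧ δ < 1 / (2 * Δ) ∧ δ < 1 / N ∧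
      δ < (1 - c) / N := by simpa only [lt_min_iff] using hδr
  rw [lt_div_iff₀ (by positivity)] at h1 h2 h3 h4
  have hKδ : N * δ ≤ 1 := by linarith
  have hmem : ∀ m, 𝒞 (hidingSet 1 hf hδ hKδ m) := by
    intro m
    refine h𝒞 hf hδ hKδ m hδa ?_
    obtain ⟨x, rfl⟩ := hf m
    refine attains_of_lt (f := f) rfl (a := (x, 0)) (a' := (x, 1))
      (fun h => zero_ne_one (congrFun (congrArg Prod.snd h) 0)) ?_
    simp only [hidingSet, if_true]
    linarith
  have hround : ∀ m : Fin N, ∀ v ≠ m,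
      ⌊(2 : ℝ) ^ B.precision * (hidingSet 1 hf hδ hKδ m).P v⌋₊ = 0 := by
    intro m v hv
    rw [Nat.floor_eq_zero]
    simp only [hidingSet, if_neg hv]
    linarith
  have hle := B.sum_prob_le (fun m => (hidingSet 1 hf hδ hKδ m).P) hround
    (fun m => {H | IsHamiltonian H ∧ 1 / Δ ≤ (hidingSet 1 hf hδ hKδ m).value H}) (L := 2 * Δ)
    (sum_indicator_good_le hf hδ hKδ hΔ (by linarith))
  have hge : p * N ≤ ∑ m, B.prob (hidingSet 1 hf hδ hKδ m).P
      {H | IsHamiltonian H ∧ 1 / Δ ≤ (hidingSet 1 hf hδ hKδ m).value H} := by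
    have := Finset.sum_le_sum fun (m : Fin N) (_ : m ∈ Finset.univ) => (hA _ (hmem m)).2
    rw [Finset.sum_const, Finset.card_univ, Fintype.card_fin, nsmul_eq_mul, mul_comm] at this
    exact this
  have hq : (B.queries : ℝ) ≤ M := by exact_mod_cast (hA _ (hmem ⟨0, hN⟩)).1
  have hq2 := pow_le_pow_left₀ (Nat.cast_nonneg _) hq 2
  linarith

lemma eventually_add_lt {p : ℝ} (hp : 0 < p) {M : ℕ → ℕ} {Δ : ℕ → ℝ}
    (hM : (fun N => (M N : ℝ)) =o[atTop] fun N : ℕ => √(N : ℝ))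
    (hΔ : Δ =o[atTop] fun N : ℕ => √(N : ℝ)) :
    ∀ᶠ N : ℕ in atTop, 0 < N ∧ 4 * Δ N + 8 * (M N : ℝ) ^ 2 < p * N := by
  have hsq : (fun N : ℕ => √(N : ℝ) ^ 2) = fun N : ℕ => (N : ℝ) := by
    funext N
    exact Real.sq_sqrt (Nat.cast_nonneg N)
  have hM2 : (fun N => (M N : ℝ) ^ 2) =o[atTop] fun N : ℕ => (N : ℝ) := by
    rw [← hsq]
    exact hM.pow two_pos
  filter_upwards [hM2.bound (show 0 < p / 32 by positivity),
    hΔ.bound (show 0 < p / 16 by positivity),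
    eventually_gt_atTop 0] with N h1 h2 hN
  have hN1 : (1 : ℝ) ≤ N := by exact_mod_cast hN
  have h3 : √(N : ℝ) ≤ N := Real.sqrt_le_iff.mpr ⟨by linarith, by nlinarith⟩
  rw [Real.norm_of_nonneg (by positivity), Real.norm_of_nonneg (by positivity)] at h1
  rw [Real.norm_of_nonneg (Real.sqrt_nonneg _)] at h2
  have h4 := (le_abs_self _).trans h2
  have h5 := mul_le_mul_of_nonneg_left h3 (show 0 ≤ p / 16 by positivity)
  have h6 : 0 < p * N := by positivity
  exact ⟨hN, by linarith⟩

end QBM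

theorem lemma2 (p : ℝ) (hp : 0 < p) (c : ℝ) (hc : c < 1)
    (M : ℕ → ℕ) (Δ : ℕ → ℝ) (hΔ_pos : ∀ N, 0 < Δ N)
    (hM : (fun N => (M N : ℝ)) =o[atTop] fun N : ℕ => √(N : ℝ))
    (hΔ : Δ =o[atTop] fun N : ℕ => √(N : ℝ)) :
    (¬ ∃ A : QBM.TrainingAlgorithm, ∃ᶠ N in atTop,
      A.Trains N (fun _ _ _ S => S.numPos = N ∧ S.Attains c) (M N) (Δ N) p) ∧
    (¬ ∃ A : QBM.TrainingAlgorithm, ∃ᶠ N in atTop,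
      A.Trains N (fun _ _ K S => K = N ∧ S.numPos = 1 ∧ S.Attains c) (M N) (Δ N) p) := by
  have hev := QBM.eventually_add_lt hp hM hΔ
  constructor
  · rintro ⟨A, hA⟩
    obtain ⟨N, hT, hN, hlt⟩ := (hA.and_eventually hev).exists
    refine hlt.not_ge (hT.le_of_hidingSet hN hc (hΔ_pos N) (allowed := fun δ => 0 < δ) ?_ ?_)
    · exact fun r hr => ⟨r / 2, by linarith, by linarith, by linarith⟩
    · exact fun hf δ hδ hKδ m h hatt => ⟨QBM.numPos_hidingSet_of_pos hf hδ hKδ h m, hatt⟩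
  · rintro ⟨A, hA⟩
    obtain ⟨N, hT, hN, hlt⟩ := (hA.and_eventually hev).exists
    refine hlt.not_ge (hT.le_of_hidingSet hN hc (hΔ_pos N) (allowed := fun δ => δ = 0) ?_ ?_)
    · exact fun r hr => ⟨0, le_rfl, hr, rfl⟩
    · exact fun hf δ hδ hKδ m h hatt =>
        ⟨rfl, QBM.numPos_hidingSet_of_eq_zero hf hδ hKδ h m, hatt⟩
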